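/- Let $a>0$ be real and let the rectangle $[0,a]\times[0,1]$ be tiled by $n$ squares with sides parallel to the axes (closed squares with union the rectangle and pairwise disjoint interiors), with side lengths $x_1,\dots,x_n$. Extend all edges of the squares to full lines across the rectangle. The resulting vertical lines (including the two vertical sides of the rectangle) cut it into $k$ columns, of widths $y_1,\dots,y_k$ from left to right, and the resulting horizontal lines (including the two horizontal sides) cut it into $l$ rows, of heights $z_1,\dots,z_l$ from bottom to top. Let $Y_i$ (resp. $Z_i$) be the set of indices $j$ of the columns (resp. rows) that meet the interior of the $i$-th square. The incidence matrix $M$ is the $(2n+2)\times N$ matrix, $N=n+k+l+2$, whose columns are indexed by the variables $1,a,x_1,\dots,x_n,y_1,\dots,y_k,z_1,\dots,z_l$ and whose rows are: $L_1$, with $-1$ at the variable $1$ and $1$ at each $z_j$; $L_2$, with $-1$ at $a$ and $1$ at each $y_j$; $R_{1,i}$ for $1\le i\le n$, with $-1$ at $x_i$ and $1$ at each $y_j$ with $j\in Y_i$; $R_{2,i}$ for $1\le i\le n$, with $-1$ at $x_i$ and $1$ at each $z_j$ with $j\in Z_i$; all other entries are $0$. Then $a$ and all $x_i$, $y_j$,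 $z_j$ are rational, and the least common multiple $D$ of their denominators (in lowest terms) satisfies $$D\le 2^{k+l-1}\le 2^n .$$ Furthermore, $M$ has $N-1$ linearly independent rows, and for every submatrix $M'$ of $M$ formed by $N-1$ linearly independent rows there is at least one $i$ such that both rows $R_{1,i}$ and $R_{2,i}$ are kept in $M'$, and $$D\le \frac{2^{k+l-2}}{x},\qquad\text{where } x=\max\{x_i \mid \text{both rows } R_{1,i}\text{ and }R_{2,i}\text{ are kept in }M'\}.$$ -/

import Mathlib

noncomputable section

/-- A tiling of the rectangle `[0, a] × [0, 1]` by `n` squares with sides parallel to the axes: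
the `i`-th square has lower left corner `corner i` and side length `side i`. The closed squares
cover exactly the rectangle and their interiors are pairwise disjoint. -/
structure SquareTiling (a : ℝ) (n : ℕ) where
  width_pos : 0 < a
  corner : Fin n → ℝ × ℝ
  side : Fin n → ℝ
  side_pos : ∀ i, 0 < side i
  cover : (⋃ i, Set.Icc (corner i).1 ((corner i).1 + side i) ×ˢ
      Set.Icc (corner i).2 ((corner i).2 + side i)) = Set.Icc 0 a ×ˢ Set.Icc 0 1
  disj : ∀ i j, i ≠ j → Disjoint
    (Set.Ioo (corner i).1 ((corner i).1 + side i) ×ˢ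
      Set.Ioo (corner i).2 ((corner i).2 + side i))
    (Set.Ioo (corner j).1 ((corner j).1 + side j) ×ˢ
      Set.Ioo (corner j).2 ((corner j).2 + side j))

namespace SquareTiling

variable {a : ℝ} {n : ℕ} (T : SquareTiling a n)

/-- Abscissae of the left and the right edge of the `i`-th square. -/
def left (i : Fin n) : ℝ := (T.corner i).1
def right (i : Fin n) : ℝ := (T.corner i).1 + T.side i

/-- Ordinates of the bottom and the top edge of the `i`-th square. -/
def bot (i : Fin n) : ℝ := (T.corner i).2
def top (i : Fin n) : ℝ := (T.corner i).2 + T.side i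

/-- Abscissae of the vertical lines of the extended grid (the two vertical sides of the
rectangle included). -/
def vLines : Finset ℝ := Finset.univ.image T.left ∪ Finset.univ.image T.right

/-- Ordinates of the horizontal lines of the extended grid (the two horizontal sides of the
rectangle included). -/
def hLines : Finset ℝ := Finset.univ.image T.bot ∪ Finset.univ.image T.top

/-- Number of columns of the extended grid, that is, of horizontal segments `y_j`. -/
def k : ℕ := T.vLines.card - 1

/-- Number of rows of the extended grid, that is, of vertical segments `z_j`. -/
def l : ℕ := T.hLines.card - 1

theorem nonempty_index (T : SquareTiling a n) : Nonempty (Fin n) := by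
  have h : ((0, 0) : ℝ × ℝ) ∈ Set.Icc (0 : ℝ) a ×ˢ Set.Icc (0 : ℝ) 1 := by
    simp [T.width_pos.le]
  rw [← T.cover, Set.mem_iUnion] at h
  exact ⟨h.choose⟩

theorem card_vLines : T.vLines.card = T.k + 1 := by
  obtain ⟨i⟩ := T.nonempty_index
  have h : 0 < T.vLines.card :=
    Finset.card_pos.mpr ⟨T.left i, by simp [vLines]⟩
  unfold k
  omega

theorem card_hLines : T.hLines.card = T.l + 1 := by
  obtain ⟨i⟩ := T.nonempty_index
  have h : 0 < T.hLines.card :=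
    Finset.card_pos.mpr ⟨T.bot i, by simp [hLines]⟩
  unfold l
  omega

/-- The vertical grid lines, from left to right. -/
def vLine : Fin (T.k + 1) ↪o ℝ := T.vLines.orderEmbOfFin T.card_vLines

/-- The horizontal grid lines, from bottom to top. -/
def hLine : Fin (T.l + 1) ↪o ℝ := T.hLines.orderEmbOfFin T.card_hLines

/-- Lengths of the horizontal segments of the extended grid, from left to right. -/
def y (j : Fin T.k) : ℝ := T.vLine j.succ - T.vLine j.castSucc

/-- Lengths of the vertical segments of the extended grid, from bottom to top. -/
def z (j : Fin T.l) : ℝ := T.hLine j.succ - T.hLine j.castSucc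

/-- `T.InY i j`: the `j`-th column of the grid meets the interior of the `i`-th square
(the horizontal segment `y_j` belongs to `Y_i`). -/
def InY (i : Fin n) (j : Fin T.k) : Prop :=
  (Set.Ioo (T.vLine j.castSucc) (T.vLine j.succ) ∩ Set.Ioo (T.left i) (T.right i)).Nonempty

/-- `T.InZ i j`: the `j`-th row of the grid meets the interior of the `i`-th square
(the vertical segment `z_j` belongs to `Z_i`). -/
def InZ (i : Fin n) (j : Fin T.l) : Prop :=
  (Set.Ioo (T.hLine j.castSucc) (T.hLine j.succ) ∩ Set.Ioo (T.bot i) (T.top i)).Nonempty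

/-- Indices of the rows of the incidence matrix: `L₁`, `L₂`, the block `R₁`, the block `R₂`. -/
abbrev Row (n : ℕ) : Type := Fin 2 ⊕ (Fin n ⊕ Fin n)

abbrev rowL1 : Row n := Sum.inl 0
abbrev rowL2 : Row n := Sum.inl 1
abbrev rowR1 (i : Fin n) : Row n := Sum.inr (Sum.inl i)
abbrev rowR2 (i : Fin n) : Row n := Sum.inr (Sum.inr i)

/-- Indices of the columns of the incidence matrix: the variables
`1`, `a`, `x_1, …, x_n`, `y_1, …, y_k`, `z_1, …, z_l`. -/
abbrev Col : Type := Fin 2 ⊕ (Fin n ⊕ (Fin T.k ⊕ Fin T.l))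

abbrev colOne : T.Col := Sum.inl 0
abbrev colA : T.Col := Sum.inl 1
abbrev colX (i : Fin n) : T.Col := Sum.inr (Sum.inl i)
abbrev colY (j : Fin T.k) : T.Col := Sum.inr (Sum.inr (Sum.inl j))
abbrev colZ (j : Fin T.l) : T.Col := Sum.inr (Sum.inr (Sum.inr j))

open Classical in
/-- The incidence matrix, with `2 n + 2` rows and `n + k + l + 2` columns. Its rows encode
`1 = ∑ z_j`, `a = ∑ y_j`, `x_i = ∑_{Y_i} y_j` and `x_i = ∑_{Z_i} z_j`. -/
def incidence : Matrix (Row n) T.Col ℝ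
  -- row `L₁`
  | Sum.inl 0, Sum.inl 0 => -1
  | Sum.inl 0, Sum.inr (Sum.inr (Sum.inr _)) => 1
  -- row `L₂`
  | Sum.inl 1, Sum.inl 1 => -1
  | Sum.inl 1, Sum.inr (Sum.inr (Sum.inl _)) => 1
  -- block `R₁`
  | Sum.inr (Sum.inl i), Sum.inr (Sum.inl i') => if i' = i then -1 else 0
  | Sum.inr (Sum.inl i), Sum.inr (Sum.inr (Sum.inl j)) => if T.InY i j then 1 else 0
  -- block `R₂`
  | Sum.inr (Sum.inr i), Sum.inr (Sum.inl i') => if i' = i then -1 else 0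
  | Sum.inr (Sum.inr i), Sum.inr (Sum.inr (Sum.inr j)) => if T.InZ i j then 1 else 0
  | _, _ => 0

/-- `S` is the set of rows of a maximal-rank submatrix: `N - 1` linearly independent rows of the
incidence matrix, where `N = n + k + l + 2` is its number of columns. -/
def IsMaxRankSelection (S : Finset (Row n)) : Prop :=
  S.card + 1 = Fintype.card T.Col ∧
    LinearIndependent ℝ (fun r : S => T.incidence r.1)

end SquareTiling

/-- The least common multiple of the denominators (in lowest terms) of a rational number and of
three finite families of rational numbers. -/
def lcmDen {n k l : ℕ} (a : ℚ) (x : Fin n → ℚ) (y : Fin k → ℚ) (z : Fin l → ℚ) : ℕ :=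
  Nat.lcm a.den (Nat.lcm (Finset.univ.lcm fun i => (x i).den)
    (Nat.lcm (Finset.univ.lcm fun j => (y j).den) (Finset.univ.lcm fun j => (z j).den)))

end

/-! The tiling gives a strictly positive kernel vector of the incidence matrix, and the kernel is no
more than its line. For a kernel vector of height 0, computing the area cell by cell with signed
widths and heights (`sum_area`) yields ∑ x_i² = 0. Opposite edges of every square then have equal
positions, and chaining squares towards the first line (`eq_of_edge_eq`) makes all widths and
heights vanish. Hence the rank is N - 1.

Positivity forces N - 1 independent rows to meet every column, so L₁, L₂ and at least one of R₁ᵢ,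
R₂ᵢ are kept for each i; counting leaves exactly k + l - 1 squares with both rows. Eliminating 1, a
and the x_i turns each of these squares into one equation "width = height" in the positions of the k
+ l + 2 grid lines, a row of norm 2. These equations fix the positions up to one scaling and two
translations (`exists_eq_add_mul`).

Pinning the left, bottom and top lines of the rectangle leaves a square system of size k + l - 1. By
Cramer and Hadamard (`exists_small_multiplier`) its determinant, at most 2^(k+l-1) in absolute
value, clears all denominators. Pinning instead the four edges of a doubled square, in units of its
side, makes its own equation redundant and leaves size k + l - 2; returning to height 1 divides the
multiplier by that side. -/

noncomputable section

/-! ### Hadamard's inequality and Cramer's rule -/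

open Finset in
/-- Hadamard's inequality for real matrices. -/
theorem abs_det_le_prod_sqrt {J : Type*} [Fintype J] [DecidableEq J] (B : Matrix J J ℝ) :
    |B.det| ≤ ∏ i, √(∑ j, B i j ^ 2) := by
  set m := Fintype.card J with hm
  let e : J ≃ Fin m := Fintype.equivFin J
  rw [← Matrix.det_submatrix_equiv_self e.symm B]
  rw [← Equiv.prod_comp e.symm]
  have : Fact (Module.finrank ℝ (EuclideanSpace ℝ (Fin m)) = m) := ⟨by simp⟩
  let b := EuclideanSpace.basisFun (Fin m) ℝ
  let v : Fin m → EuclideanSpace ℝ (Fin m) := fun i =>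
    WithLp.toLp 2 fun j => B (e.symm i) (e.symm j)
  let o := b.toBasis.orientation
  have h := o.abs_volumeForm_apply_le v
  rw [o.volumeForm_robust b rfl] at h
  have h1 : b.toBasis.det v = (B.submatrix e.symm e.symm).det := by
    -- The matrix of a family in a basis has the vectors as columns, whereas here they are rows.
    rw [Module.Basis.det_apply, ← Matrix.det_transpose]
    congr 1
  rw [h1] at h
  refine h.trans_eq (Finset.prod_congr rfl fun i _ => ?_)
  rw [EuclideanSpace.norm_eq]
  simp only [Real.norm_eq_abs, sq_abs]
  congr 1
  exact Equiv.sum_comp e.symm fun j => B (e.symm i) j ^ 2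

/-- A homogeneous integral system with short rows which determines a vector from its entries outside
of `R`: there is a small nonzero integer clearing the denominators of all solutions
that are integral outside of `R`. -/
theorem exists_small_multiplier {V J : Type*} [Fintype V] [DecidableEq V] [Fintype J]
    [DecidableEq J] (A : Matrix J V ℤ) (hrow : ∀ i, ∑ v, A i v ^ 2 ≤ 4) (R : Finset V)
    (hcard : R.card = Fintype.card J)
    (hinj : ∀ u : V → ℝ, (∀ v ∉ R, u v = 0) → (∀ i, ∑ v, (A i v : ℝ) * u v = 0) → u = 0) :
    ∃ d : ℤ, d ≠ 0 ∧ |(d : ℝ)| ≤ 2 ^ Fintype.card J ∧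
      ∀ w : V → ℝ, (∀ v ∉ R, ∃ z : ℤ, w v = z) → (∀ i, ∑ v, (A i v : ℝ) * w v = 0) →
        ∀ v, ∃ z : ℤ, d * w v = z := by
  have e : J ≃ R := Fintype.equivOfCardEq (by simp [hcard])
  let B : Matrix J J ℤ := fun i j => A i (e j)
  have hsum : ∀ g : V → ℝ, ∑ v, g v = ∑ j, g (e j) + ∑ v ∈ Rᶜ, g v := by
    intro g
    rw [← Finset.sum_add_sum_compl R, ← Finset.sum_coe_sort, Equiv.sum_comp e fun v => g v]
  have hB : B.map (Int.cast : ℤ → ℝ) = (Int.castRingHom ℝ).mapMatrix B := rfl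
  have hBdet : ((B.map (Int.cast : ℤ → ℝ)).det : ℝ) = (B.det : ℝ) := by
    rw [hB, ← RingHom.map_det]; rfl
  refine ⟨B.det, ?_, ?_, ?_⟩
  · intro h0
    have h0' : (B.map (Int.cast : ℤ → ℝ)).det = 0 := by rw [hBdet, h0]; simp
    obtain ⟨u, hu, hBu⟩ := Matrix.exists_mulVec_eq_zero_iff.mpr h0'
    -- A kernel vector of the square block, extended by zero outside `R`, solves the whole system
    -- and contradicts `hinj`.
    let u' : V → ℝ := fun v => if h : v ∈ R then u (e.symm ⟨v, h⟩) else 0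
    have hu' : ∀ j, u' (e j) = u j := by intro j; simp [u']
    have : u' = 0 := by
      refine hinj u' (fun v hv => by simp [u', hv]) fun i => ?_
      rw [hsum]
      have h2 : ∑ v ∈ Rᶜ, (A i v : ℝ) * u' v = 0 := by
        refine Finset.sum_eq_zero fun v hv => ?_
        have : v ∉ R := by simpa using hv
        simp [u', this]
      rw [h2, add_zero]
      simp only [hu']
      exact congrFun hBu i
    apply hu
    ext j
    rw [← hu', this]; rfl
  · rw [← hBdet]
    refine (abs_det_le_prod_sqrt _).trans ?_
    rw [← Finset.card_univ, ← Finset.prod_const]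
    refine Finset.prod_le_prod (fun _ _ => Real.sqrt_nonneg _) fun i _ => ?_
    rw [Real.sqrt_le_iff]
    refine ⟨by norm_num, ?_⟩
    -- Restricting a row to `R` only shortens it, so each Hadamard factor is at most √4 = 2.
    have h1 : ∑ j, (B i j : ℝ) ^ 2 ≤ ∑ v, (A i v : ℝ) ^ 2 := by
      rw [hsum]
      exact le_add_of_nonneg_right (Finset.sum_nonneg fun _ _ => sq_nonneg _)
    have h2 : ∑ v, (A i v : ℝ) ^ 2 ≤ 4 := by exact_mod_cast hrow i
    simpa using (h1.trans h2).trans (by norm_num)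
  · intro w hw hAw v
    by_cases hv : v ∈ R
    swap
    · obtain ⟨z, hz⟩ := hw v hv
      exact ⟨B.det * z, by simp [hz]⟩
    obtain ⟨j, hj⟩ := e.surjective ⟨v, hv⟩
    choose f hf using hw
    -- The known integral entries, moved to the right-hand side; the default 0 is never reached, as
    -- `x` ranges over the complement of `R`.
    let c : J → ℤ := fun i => -∑ x ∈ Rᶜ, if h : x ∈ R then 0 else A i x * f x h
    have hBw : (B.map (Int.cast : ℤ → ℝ)).mulVec (fun j => w (e j)) = fun i => (c i : ℝ) := by
      ext i
      have h := hAw i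
      rw [hsum] at h
      have h3 : ∑ v ∈ Rᶜ, (A i v : ℝ) * w v = -(c i : ℝ) := by
        simp only [c, Int.cast_neg, neg_neg, Int.cast_sum]
        refine Finset.sum_congr rfl fun x hx => ?_
        have hx' : x ∉ R := by simpa using hx
        simp [hx', hf x hx']
      rw [h3] at h
      change ∑ j, (B i j : ℝ) * w (e j) = _
      simp only [B]
      linarith
    -- Cramer's rule: the adjugate is integral, so the determinant times the unknowns is integral.
    have key := congrArg (fun u => (B.map (Int.cast : ℤ → ℝ)).adjugate.mulVec u) hBw
    simp only [Matrix.mulVec_mulVec, Matrix.adjugate_mul, Matrix.smul_mulVec,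
      Matrix.one_mulVec] at key
    refine ⟨(B.adjugate.mulVec c) j, ?_⟩
    have hk := congrFun key j
    rw [hBdet, hB, ← RingHom.map_adjugate] at hk
    simp only [Pi.smul_apply, smul_eq_mul, hj] at hk
    rw [hk]
    simp [Matrix.mulVec, dotProduct]

/-! ### Telescoping and potentials on grid lines -/

theorem Fin.sum_succ_sub_castSucc {k : ℕ} (f : Fin (k + 1) → ℝ) :
    ∑ j : Fin k, (f j.succ - f j.castSucc) = f (Fin.last k) - f 0 := by
  induction k with
  | zero => simp
  | succ k ih =>
    rw [Fin.sum_univ_castSucc]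
    have := ih fun j => f j.castSucc
    simp only [Fin.castSucc_zero, ← Fin.succ_castSucc] at this
    rw [this]
    simp

open Classical in
theorem Fin.sum_ite_succ_sub_castSucc {k : ℕ} (f : Fin (k + 1) → ℝ) {l r : Fin (k + 1)}
    (h : l ≤ r) :
    ∑ j : Fin k, (if l ≤ j.castSucc ∧ j.succ ≤ r then f j.succ - f j.castSucc else 0) =
      f r - f l := by
  -- Clamping the index to [l, r] kills the increments outside and keeps those inside.
  have := Fin.sum_succ_sub_castSucc fun m => f (max l (min m r))
  have h1 : max l (min (Fin.last k) r) = r := by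
    rw [min_eq_right (Fin.le_last r), max_eq_right h]
  have h0 : max l (min 0 r) = l := by
    rw [min_eq_left (Fin.zero_le r), max_eq_left (Fin.zero_le l)]
  simp only [h1, h0] at this
  rw [← this]
  refine Finset.sum_congr rfl fun j _ => ?_
  have hj : j.castSucc < j.succ := Fin.castSucc_lt_succ
  split_ifs with hc
  · rw [min_eq_left hc.2, min_eq_left (hj.le.trans hc.2), max_eq_right hc.1,
      max_eq_right (hc.1.trans hj.le)]
  · rw [not_and_or, not_le, not_le] at hc
    rcases hc with hc | hc
    · have h2 : j.succ ≤ l := Fin.castSucc_lt_iff_succ_le.mp hc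
      rw [max_eq_left ((min_le_left _ _).trans h2), max_eq_left ((min_le_left _ _).trans hc.le),
        sub_self]
    · have h2 : r ≤ j.castSucc := Fin.le_castSucc_iff.mpr hc
      rw [min_eq_right h2, min_eq_right hc.le, sub_self]

/-- Every family of increments comes from a potential. -/
theorem Fin.exists_potential {k : ℕ} (y : Fin k → ℝ) :
    ∃ p : Fin (k + 1) → ℝ, ∀ j : Fin k, p j.succ - p j.castSucc = y j := by
  refine ⟨fun m => ∑ j : Fin k, if j.castSucc < m then y j else 0, fun j => ?_⟩
  rw [← Finset.sum_sub_distrib, Finset.sum_eq_single j]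
  · simp
  · intro b _ hb
    have : b.castSucc < j.succ ↔ b.castSucc < j.castSucc := by
      simp only [Fin.lt_def, Fin.val_castSucc, Fin.val_succ]
      have : b.val ≠ j.val := fun h => hb (Fin.ext h)
      omega
    simp [this]
  · simp

theorem Fin.eq_of_forall_succ_eq_castSucc {k : ℕ} {f : Fin (k + 1) → ℝ}
    (h : ∀ j : Fin k, f j.succ = f j.castSucc) (m : Fin (k + 1)) : f m = f 0 := by
  induction m using Fin.induction with
  | zero => rfl
  | succ j ih => rw [h j, ih]

/-- In a grid partitioned into blocks, such that each vertical grid line carries an edge of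
a block, a function on the vertical lines with equal values at both edges of each block
is constant. -/
theorem eq_of_edge_eq {ι : Type*} {k m : ℕ} {l r : ι → Fin (k + 1)}
    (hlr : ∀ i, l i < r i) (Z : ι → Fin m → Prop) (hZ : ∀ i, ∃ j, Z i j)
    (hcell : ∀ (j : Fin k) (j' : Fin m),
      ∃! i, (l i ≤ j.castSucc ∧ j.succ ≤ r i) ∧ Z i j')
    (hline : ∀ q, ∃ i, l i = q ∨ r i = q) {f : Fin (k + 1) → ℝ} (hf : ∀ i, f (r i) = f (l i)) :
    ∀ q, f q = f 0 := by
  -- If a block starts at `q`, look one cell back in a row that it meets: the block found there must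
  -- end at `q`, since otherwise it would also contain the first cell of the starting block.
  have hright : ∀ q, q ≠ 0 → ∃ i, r i = q := by
    intro q hq
    obtain ⟨i, hi | hi⟩ := hline q
    swap
    · exact ⟨i, hi⟩
    obtain ⟨j', hj'⟩ := hZ i
    obtain ⟨p, rfl⟩ := Fin.exists_succ_eq.mpr hq
    obtain ⟨i₂, ⟨⟨h1, h2⟩, h3⟩, -⟩ := hcell p j'
    refine ⟨i₂, ?_⟩
    by_contra hne
    have hlt : p.succ < r i₂ := lt_of_le_of_ne h2 (Ne.symm hne)
    have hpk : p.val + 1 < k := by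
      have := (r i₂).isLt
      rw [Fin.lt_def, Fin.val_succ] at hlt
      omega
    let c : Fin k := ⟨p.val + 1, hpk⟩
    have hc : c.castSucc = p.succ := Fin.ext rfl
    obtain ⟨_, -, hu⟩ := hcell c j'
    have e1 := hu i ⟨⟨by rw [hc, hi], by
      rw [← Fin.castSucc_lt_iff_succ_le, hc, ← hi]; exact hlr i⟩, hj'⟩
    have e2 := hu i₂ ⟨⟨by rw [hc]; exact h1.trans Fin.castSucc_lt_succ.le, by
      rw [← Fin.castSucc_lt_iff_succ_le, hc]; exact hlt⟩, h3⟩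
    rw [e2, ← e1, hi] at h1
    exact absurd h1 (not_le.mpr Fin.castSucc_lt_succ)
  intro q
  induction q using WellFoundedLT.induction with
  | ind q ih =>
    by_cases hq : q = 0
    · rw [hq]
    obtain ⟨i, rfl⟩ := hright q hq
    rw [hf i, ih _ (hlr i)]

/-! ### The extended grid of a tiling -/

namespace SquareTiling

variable {a : ℝ} {n : ℕ} (T : SquareTiling a n)

theorem left_lt_right (i : Fin n) : T.left i < T.right i := by
  have := T.side_pos i
  unfold left right; linarith

theorem bot_lt_top (i : Fin n) : T.bot i < T.top i := by
  have := T.side_pos i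
  unfold bot top; linarith

theorem right_sub_left (i : Fin n) : T.right i - T.left i = T.side i := by
  unfold left right; ring

theorem top_sub_bot (i : Fin n) : T.top i - T.bot i = T.side i := by
  unfold bot top; ring

theorem mem_range_vLine {t : ℝ} : t ∈ Set.range T.vLine ↔ ∃ i, T.left i = t ∨ T.right i = t := by
  rw [vLine, Finset.range_orderEmbOfFin]
  simp [vLines, exists_or]

theorem mem_range_hLine {t : ℝ} : t ∈ Set.range T.hLine ↔ ∃ i, T.bot i = t ∨ T.top i = t := by
  rw [hLine, Finset.range_orderEmbOfFin]
  simp [hLines, exists_or]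

theorem exists_vLine_eq_left (i : Fin n) : ∃ m, T.vLine m = T.left i :=
  T.mem_range_vLine.mpr ⟨i, Or.inl rfl⟩

theorem exists_vLine_eq_right (i : Fin n) : ∃ m, T.vLine m = T.right i :=
  T.mem_range_vLine.mpr ⟨i, Or.inr rfl⟩

theorem exists_hLine_eq_bot (i : Fin n) : ∃ m, T.hLine m = T.bot i :=
  T.mem_range_hLine.mpr ⟨i, Or.inl rfl⟩

theorem exists_hLine_eq_top (i : Fin n) : ∃ m, T.hLine m = T.top i :=
  T.mem_range_hLine.mpr ⟨i, Or.inr rfl⟩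

/-- Indices of the grid lines carrying the edges of the `i`-th square. -/
def leftIx (i : Fin n) : Fin (T.k + 1) := (T.exists_vLine_eq_left i).choose
def rightIx (i : Fin n) : Fin (T.k + 1) := (T.exists_vLine_eq_right i).choose
def botIx (i : Fin n) : Fin (T.l + 1) := (T.exists_hLine_eq_bot i).choose
def topIx (i : Fin n) : Fin (T.l + 1) := (T.exists_hLine_eq_top i).choose

theorem vLine_leftIx (i : Fin n) : T.vLine (T.leftIx i) = T.left i :=
  (T.exists_vLine_eq_left i).choose_spec
theorem vLine_rightIx (i : Fin n) : T.vLine (T.rightIx i) = T.right i :=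
  (T.exists_vLine_eq_right i).choose_spec
theorem hLine_botIx (i : Fin n) : T.hLine (T.botIx i) = T.bot i :=
  (T.exists_hLine_eq_bot i).choose_spec
theorem hLine_topIx (i : Fin n) : T.hLine (T.topIx i) = T.top i :=
  (T.exists_hLine_eq_top i).choose_spec

theorem leftIx_lt_rightIx (i : Fin n) : T.leftIx i < T.rightIx i := by
  rw [← T.vLine.lt_iff_lt, vLine_leftIx, vLine_rightIx]
  exact T.left_lt_right i

theorem botIx_lt_topIx (i : Fin n) : T.botIx i < T.topIx i := by
  rw [← T.hLine.lt_iff_lt, hLine_botIx, hLine_topIx]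
  exact T.bot_lt_top i

theorem exists_leftIx_or_rightIx (q : Fin (T.k + 1)) :
    ∃ i, T.leftIx i = q ∨ T.rightIx i = q := by
  obtain ⟨i, h⟩ := T.mem_range_vLine.mp ⟨q, rfl⟩
  refine ⟨i, h.imp (fun h => T.vLine.injective ?_) (fun h => T.vLine.injective ?_)⟩
  · rw [vLine_leftIx, h]
  · rw [vLine_rightIx, h]

theorem exists_botIx_or_topIx (q : Fin (T.l + 1)) :
    ∃ i, T.botIx i = q ∨ T.topIx i = q := by
  obtain ⟨i, h⟩ := T.mem_range_hLine.mp ⟨q, rfl⟩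
  refine ⟨i, h.imp (fun h => T.hLine.injective ?_) (fun h => T.hLine.injective ?_)⟩
  · rw [hLine_botIx, h]
  · rw [hLine_topIx, h]

theorem inY_iff (i : Fin n) (j : Fin T.k) :
    T.InY i j ↔ T.leftIx i ≤ j.castSucc ∧ j.succ ≤ T.rightIx i := by
  have hj : T.vLine j.castSucc < T.vLine j.succ := T.vLine.lt_iff_lt.mpr Fin.castSucc_lt_succ
  have hi := T.left_lt_right i
  rw [InY, Set.Ioo_inter_Ioo, Set.nonempty_Ioo]
  simp only [max_lt_iff, lt_min_iff, hj, hi, and_true, true_and]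
  rw [← vLine_leftIx, ← vLine_rightIx, T.vLine.lt_iff_lt, T.vLine.lt_iff_lt,
    Fin.castSucc_lt_iff_succ_le, ← Fin.le_castSucc_iff, and_comm]

theorem inZ_iff (i : Fin n) (j : Fin T.l) :
    T.InZ i j ↔ T.botIx i ≤ j.castSucc ∧ j.succ ≤ T.topIx i := by
  have hj : T.hLine j.castSucc < T.hLine j.succ := T.hLine.lt_iff_lt.mpr Fin.castSucc_lt_succ
  have hi := T.bot_lt_top i
  rw [InZ, Set.Ioo_inter_Ioo, Set.nonempty_Ioo]
  simp only [max_lt_iff, lt_min_iff, hj, hi, and_true, true_and]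
  rw [← hLine_botIx, ← hLine_topIx, T.hLine.lt_iff_lt, T.hLine.lt_iff_lt,
    Fin.castSucc_lt_iff_succ_le, ← Fin.le_castSucc_iff, and_comm]

theorem exists_inY (i : Fin n) : ∃ j, T.InY i j := by
  have h := T.leftIx_lt_rightIx i
  refine ⟨(T.leftIx i).castPred (ne_of_lt (h.trans_le (Fin.le_last _))), ?_⟩
  rw [inY_iff, ← Fin.castSucc_lt_iff_succ_le]
  simpa using h

theorem exists_inZ (i : Fin n) : ∃ j, T.InZ i j := by
  have h := T.botIx_lt_topIx i
  refine ⟨(T.botIx i).castPred (ne_of_lt (h.trans_le (Fin.le_last _))), ?_⟩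
  rw [inZ_iff, ← Fin.castSucc_lt_iff_succ_le]
  simpa using h

theorem exists_mem_square {u v : ℝ} (hu : u ∈ Set.Icc 0 a) (hv : v ∈ Set.Icc (0 : ℝ) 1) :
    ∃ i, (T.left i ≤ u ∧ u ≤ T.right i) ∧ T.bot i ≤ v ∧ v ≤ T.top i := by
  have h : (u, v) ∈ Set.Icc (0 : ℝ) a ×ˢ Set.Icc (0 : ℝ) 1 := ⟨hu, hv⟩
  rw [← T.cover, Set.mem_iUnion] at h
  obtain ⟨i, h⟩ := h
  exact ⟨i, h.1, h.2⟩

theorem square_subset (i : Fin n) :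
    (0 ≤ T.left i ∧ T.right i ≤ a) ∧ 0 ≤ T.bot i ∧ T.top i ≤ 1 := by
  have h1 : ((T.left i, T.bot i) : ℝ × ℝ) ∈ Set.Icc (0 : ℝ) a ×ˢ Set.Icc (0 : ℝ) 1 := by
    rw [← T.cover, Set.mem_iUnion]
    exact ⟨i, ⟨le_rfl, (T.left_lt_right i).le⟩, le_rfl, (T.bot_lt_top i).le⟩
  have h2 : ((T.right i, T.top i) : ℝ × ℝ) ∈ Set.Icc (0 : ℝ) a ×ˢ Set.Icc (0 : ℝ) 1 := by
    rw [← T.cover, Set.mem_iUnion]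
    exact ⟨i, ⟨(T.left_lt_right i).le, le_rfl⟩, (T.bot_lt_top i).le, le_rfl⟩
  exact ⟨⟨h1.1.1, h2.1.2⟩, h1.2.1, h2.2.2⟩

theorem vLine_mem_Icc (q : Fin (T.k + 1)) : T.vLine q ∈ Set.Icc 0 a := by
  obtain ⟨i, h⟩ := T.mem_range_vLine.mp ⟨q, rfl⟩
  have h1 := T.square_subset i
  have h2 := T.left_lt_right i
  rcases h with h | h <;> rw [← h] <;> constructor <;> linarith [h1.1.1, h1.1.2]

theorem hLine_mem_Icc (q : Fin (T.l + 1)) : T.hLine q ∈ Set.Icc (0 : ℝ) 1 := by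
  obtain ⟨i, h⟩ := T.mem_range_hLine.mp ⟨q, rfl⟩
  have h1 := T.square_subset i
  have h2 := T.bot_lt_top i
  rcases h with h | h <;> rw [← h] <;> constructor <;> linarith [h1.2.1, h1.2.2]

theorem vLine_zero : T.vLine 0 = 0 := by
  obtain ⟨i, h1, -⟩ := T.exists_mem_square (u := 0) (v := 0) ⟨le_rfl, T.width_pos.le⟩
    ⟨le_rfl, zero_le_one⟩
  refine le_antisymm ?_ (T.vLine_mem_Icc 0).1
  exact (T.vLine.monotone (Fin.zero_le (T.leftIx i))).trans (by rw [vLine_leftIx]; exact h1.1)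

theorem hLine_zero : T.hLine 0 = 0 := by
  obtain ⟨i, -, h1⟩ := T.exists_mem_square (u := 0) (v := 0) ⟨le_rfl, T.width_pos.le⟩
    ⟨le_rfl, zero_le_one⟩
  refine le_antisymm ?_ (T.hLine_mem_Icc 0).1
  exact (T.hLine.monotone (Fin.zero_le (T.botIx i))).trans (by rw [hLine_botIx]; exact h1.1)

theorem vLine_last : T.vLine (Fin.last _) = a := by
  obtain ⟨i, h1, -⟩ := T.exists_mem_square (u := a) (v := 0) ⟨T.width_pos.le, le_rfl⟩
    ⟨le_rfl, zero_le_one⟩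
  refine le_antisymm (T.vLine_mem_Icc _).2 ?_
  refine le_trans ?_ (T.vLine.monotone (Fin.le_last (T.rightIx i)))
  rw [vLine_rightIx]; exact h1.2

theorem hLine_last : T.hLine (Fin.last _) = 1 := by
  obtain ⟨i, -, h1⟩ := T.exists_mem_square (u := 0) (v := 1) ⟨le_rfl, T.width_pos.le⟩
    ⟨zero_le_one, le_rfl⟩
  refine le_antisymm (T.hLine_mem_Icc _).2 ?_
  refine le_trans ?_ (T.hLine.monotone (Fin.le_last (T.topIx i)))
  rw [hLine_topIx]; exact h1.2

theorem k_pos : 0 < T.k := by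
  obtain ⟨i⟩ := T.nonempty_index
  obtain ⟨j, -⟩ := T.exists_inY i
  exact j.pos

theorem l_pos : 0 < T.l := by
  obtain ⟨i⟩ := T.nonempty_index
  obtain ⟨j, -⟩ := T.exists_inZ i
  exact j.pos

/-- The centre of the cell lies in some closed square. No edge line runs through the open cell, so
this square covers the cell; two squares doing so would share the centre in their interiors. -/
theorem existsUnique_square (j : Fin T.k) (j' : Fin T.l) : ∃! i, T.InY i j ∧ T.InZ i j' := by
  have hj : T.vLine j.castSucc < T.vLine j.succ := T.vLine.lt_iff_lt.mpr Fin.castSucc_lt_succ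
  have hj' : T.hLine j'.castSucc < T.hLine j'.succ := T.hLine.lt_iff_lt.mpr Fin.castSucc_lt_succ
  set u := (T.vLine j.castSucc + T.vLine j.succ) / 2 with hu
  set v := (T.hLine j'.castSucc + T.hLine j'.succ) / 2 with hv
  obtain ⟨i, ⟨h1, h2⟩, h3, h4⟩ := T.exists_mem_square (u := u) (v := v)
    (by have := T.vLine_mem_Icc j.castSucc; have := T.vLine_mem_Icc j.succ
        simp only [Set.mem_Icc] at *; constructor <;> linarith)
    (by have := T.hLine_mem_Icc j'.castSucc; have := T.hLine_mem_Icc j'.succ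
        simp only [Set.mem_Icc] at *; constructor <;> linarith)
  refine ⟨i, ⟨?_, ?_⟩, fun i₂ hi₂ => ?_⟩
  · rw [inY_iff, Fin.le_castSucc_iff, ← Fin.castSucc_lt_iff_succ_le, ← T.vLine.lt_iff_lt,
      ← T.vLine.lt_iff_lt, vLine_leftIx, vLine_rightIx]
    constructor <;> linarith
  · rw [inZ_iff, Fin.le_castSucc_iff, ← Fin.castSucc_lt_iff_succ_le, ← T.hLine.lt_iff_lt,
      ← T.hLine.lt_iff_lt, hLine_botIx, hLine_topIx]
    constructor <;> linarith
  · simp only [inY_iff, inZ_iff] at hi₂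
    rw [← T.vLine.le_iff_le, ← T.vLine.le_iff_le, vLine_leftIx, vLine_rightIx,
      ← T.hLine.le_iff_le, ← T.hLine.le_iff_le, hLine_botIx, hLine_topIx] at hi₂
    obtain ⟨⟨g1, g2⟩, g3, g4⟩ := hi₂
    -- the midpoint is on no grid line, so it lies in the open square
    have hl : T.left i < T.vLine j.succ := by linarith
    have hr : T.vLine j.castSucc < T.right i := by linarith
    have hb : T.bot i < T.hLine j'.succ := by linarith
    have ht : T.hLine j'.castSucc < T.top i := by linarith
    rw [← vLine_leftIx, T.vLine.lt_iff_lt, ← Fin.le_castSucc_iff, ← T.vLine.le_iff_le,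
      vLine_leftIx] at hl
    rw [← vLine_rightIx, T.vLine.lt_iff_lt, Fin.castSucc_lt_iff_succ_le, ← T.vLine.le_iff_le,
      vLine_rightIx] at hr
    rw [← hLine_botIx, T.hLine.lt_iff_lt, ← Fin.le_castSucc_iff, ← T.hLine.le_iff_le,
      hLine_botIx] at hb
    rw [← hLine_topIx, T.hLine.lt_iff_lt, Fin.castSucc_lt_iff_succ_le, ← T.hLine.le_iff_le,
      hLine_topIx] at ht
    by_contra hne
    refine (Set.disjoint_left.mp (T.disj i₂ i hne) : ∀ ⦃w : ℝ × ℝ⦄, _ → _) (?_ : (u, v) ∈ _) ?_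
    · change (T.left i₂ < u ∧ u < T.right i₂) ∧ (T.bot i₂ < v ∧ v < T.top i₂)
      refine ⟨⟨?_, ?_⟩, ?_, ?_⟩ <;> linarith
    · change (T.left i < u ∧ u < T.right i) ∧ (T.bot i < v ∧ v < T.top i)
      refine ⟨⟨?_, ?_⟩, ?_, ?_⟩ <;> linarith

theorem vertical_eq_of_edge_eq {f : Fin (T.k + 1) → ℝ}
    (hf : ∀ i, f (T.rightIx i) = f (T.leftIx i)) (q : Fin (T.k + 1)) : f q = f 0 := by
  refine eq_of_edge_eq T.leftIx_lt_rightIx T.InZ T.exists_inZ (fun j j' => ?_)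
    T.exists_leftIx_or_rightIx hf q
  simpa only [inY_iff] using T.existsUnique_square j j'

theorem horizontal_eq_of_edge_eq {f : Fin (T.l + 1) → ℝ}
    (hf : ∀ i, f (T.topIx i) = f (T.botIx i)) (q : Fin (T.l + 1)) : f q = f 0 := by
  refine eq_of_edge_eq T.botIx_lt_topIx T.InY T.exists_inY (fun j j' => ?_)
    T.exists_botIx_or_topIx hf q
  simpa only [inZ_iff, and_comm] using T.existsUnique_square j' j

open Classical in
theorem sum_inY (f : Fin (T.k + 1) → ℝ) (i : Fin n) :
    ∑ j, (if T.InY i j then f j.succ - f j.castSucc else 0) =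
      f (T.rightIx i) - f (T.leftIx i) := by
  simp only [inY_iff]
  exact Fin.sum_ite_succ_sub_castSucc f (T.leftIx_lt_rightIx i).le

open Classical in
theorem sum_inZ (f : Fin (T.l + 1) → ℝ) (i : Fin n) :
    ∑ j, (if T.InZ i j then f j.succ - f j.castSucc else 0) =
      f (T.topIx i) - f (T.botIx i) := by
  simp only [inZ_iff]
  exact Fin.sum_ite_succ_sub_castSucc f (T.botIx_lt_topIx i).le

open Classical in
/-- The area of the rectangle is the sum of the areas of the squares, for arbitrary
(possibly negative) widths and heights. -/
theorem sum_area (y : Fin T.k → ℝ) (z : Fin T.l → ℝ) :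
    ∑ i, (∑ j, if T.InY i j then y j else 0) * (∑ j, if T.InZ i j then z j else 0) =
      (∑ j, y j) * ∑ j, z j := by
  -- After exchanging sums, the coefficient of `y j * z j'` counts the squares covering that cell,
  -- which is 1.
  simp only [Finset.sum_mul_sum]
  rw [Finset.sum_comm]
  refine Finset.sum_congr rfl fun j _ => ?_
  rw [Finset.sum_comm]
  refine Finset.sum_congr rfl fun j' _ => ?_
  obtain ⟨i, hi, hu⟩ := T.existsUnique_square j j'
  rw [Finset.sum_eq_single i]
  · simp [hi.1, hi.2]
  · intro b _ hb
    by_cases h1 : T.InY b j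
    · by_cases h2 : T.InZ b j'
      · exact absurd (hu b ⟨h1, h2⟩) hb
      · simp [h2]
    · simp [h1]
  · simp

end SquareTiling

/-! ### Kernel and rank of the incidence matrix -/

theorem Matrix.eq_smul_of_rank_add_one_eq {R C : Type*} [Fintype R] [Fintype C]
    {M : Matrix R C ℝ} (hM : M.rank + 1 = Fintype.card C) {v₀ v : C → ℝ} (h₀ : v₀ ≠ 0)
    (hv₀ : M.mulVec v₀ = 0) (hv : M.mulVec v = 0) : ∃ c : ℝ, v = c • v₀ := by
  have h := M.mulVecLin.finrank_range_add_finrank_ker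
  rw [Module.finrank_fintype_fun_eq_card, ← hM] at h
  have h1 : Module.finrank ℝ (LinearMap.ker M.mulVecLin) = 1 := by
    have : Module.finrank ℝ (LinearMap.range M.mulVecLin) = M.rank := rfl
    omega
  have hne : (⟨v₀, hv₀⟩ : LinearMap.ker M.mulVecLin) ≠ 0 := fun h => h₀ (congrArg Subtype.val h)
  obtain ⟨c, hc⟩ := (finrank_eq_one_iff_of_nonzero' _ hne).mp h1 ⟨v, hv⟩
  exact ⟨c, (congrArg Subtype.val hc).symm⟩

namespace SquareTiling

variable {a : ℝ} {n : ℕ} (T : SquareTiling a n)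

theorem mulVec_rowL1 (v : T.Col → ℝ) :
    T.incidence.mulVec v rowL1 = -v T.colOne + ∑ j, v (T.colZ j) := by
  simp [Matrix.mulVec, dotProduct, incidence]

theorem mulVec_rowL2 (v : T.Col → ℝ) :
    T.incidence.mulVec v rowL2 = -v T.colA + ∑ j, v (T.colY j) := by
  simp [Matrix.mulVec, dotProduct, incidence]

open Classical in
theorem mulVec_rowR1 (v : T.Col → ℝ) (i : Fin n) :
    T.incidence.mulVec v (rowR1 i) =
      -v (T.colX i) + ∑ j, if T.InY i j then v (T.colY j) else 0 := by
  simp [Matrix.mulVec, dotProduct, incidence]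

open Classical in
theorem mulVec_rowR2 (v : T.Col → ℝ) (i : Fin n) :
    T.incidence.mulVec v (rowR2 i) =
      -v (T.colX i) + ∑ j, if T.InZ i j then v (T.colZ j) else 0 := by
  simp [Matrix.mulVec, dotProduct, incidence]

/-- The solution of the incidence system given by the tiling. -/
def solution : T.Col → ℝ :=
  Sum.elim ![1, a] (Sum.elim T.side (Sum.elim T.y T.z))

theorem solution_pos (c : T.Col) : 0 < T.solution c := by
  rcases c with c | i | j | j
  · fin_cases c
    · exact one_pos
    · exact T.width_pos
  · exact T.side_pos i
  · exact sub_pos.mpr (T.vLine.lt_iff_lt.mpr Fin.castSucc_lt_succ)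
  · exact sub_pos.mpr (T.hLine.lt_iff_lt.mpr Fin.castSucc_lt_succ)

theorem solution_ne_zero : T.solution ≠ 0 := fun h =>
  (T.solution_pos T.colOne).ne' (congrFun h _)

theorem mulVec_solution : T.incidence.mulVec T.solution = 0 := by
  ext r
  rcases r with r | i | i
  · fin_cases r
    · refine (T.mulVec_rowL1 _).trans ?_
      change -1 + ∑ j, T.z j = 0
      simp only [z]
      rw [Fin.sum_succ_sub_castSucc T.hLine, hLine_last, hLine_zero]
      ring
    · refine (T.mulVec_rowL2 _).trans ?_
      change -a + ∑ j, T.y j = 0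
      simp only [y]
      rw [Fin.sum_succ_sub_castSucc T.vLine, vLine_last, vLine_zero]
      ring
  · classical
    refine (T.mulVec_rowR1 _ i).trans ?_
    change -T.side i + ∑ j, (if T.InY i j then T.y j else 0) = 0
    simp only [y]
    rw [T.sum_inY T.vLine, vLine_leftIx, vLine_rightIx, right_sub_left]
    ring
  · classical
    refine (T.mulVec_rowR2 _ i).trans ?_
    change -T.side i + ∑ j, (if T.InZ i j then T.z j else 0) = 0
    simp only [z]
    rw [T.sum_inZ T.hLine, hLine_botIx, hLine_topIx, top_sub_bot]
    ring

/-- A solution of the incidence system with height `0` vanishes. -/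
theorem eq_zero_of_mulVec_eq_zero {v : T.Col → ℝ} (hv : T.incidence.mulVec v = 0)
    (h1 : v T.colOne = 0) : v = 0 := by
  classical
  have e1 := T.mulVec_rowL1 v
  have e2 := T.mulVec_rowL2 v
  have e3 := T.mulVec_rowR1 v
  have e4 := T.mulVec_rowR2 v
  simp only [hv, Pi.zero_apply, h1, neg_zero, zero_add] at e1 e2 e3 e4
  have hx : ∀ i, v (T.colX i) = 0 := by
    -- Total height 0 makes the signed area vanish, while each square contributes x_i².
    have h := T.sum_area (fun j => v (T.colY j)) (fun j => v (T.colZ j))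
    rw [← e1, mul_zero] at h
    have h2 : ∑ i, v (T.colX i) * v (T.colX i) = 0 := by
      rw [← h]
      refine Finset.sum_congr rfl fun i _ => ?_
      congr 1
      · linarith [e3 i]
      · linarith [e4 i]
    intro i
    exact mul_self_eq_zero.mp
      ((Finset.sum_eq_zero_iff_of_nonneg fun _ _ => mul_self_nonneg _).mp h2 i (Finset.mem_univ i))
  have hy : ∀ j, v (T.colY j) = 0 := by
    -- With all x_i = 0, a potential of the widths agrees on both vertical edges of every square,
    -- hence is constant.
    obtain ⟨p, hp⟩ := Fin.exists_potential fun j => v (T.colY j)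
    have hc := T.vertical_eq_of_edge_eq (f := p) fun i => by
      have := e3 i
      simp only [← hp, hx] at this
      rw [T.sum_inY p i] at this
      linarith
    intro j
    have := hp j
    rw [hc j.succ, hc j.castSucc, sub_self] at this
    exact this.symm
  have hz : ∀ j, v (T.colZ j) = 0 := by
    obtain ⟨p, hp⟩ := Fin.exists_potential fun j => v (T.colZ j)
    have hc := T.horizontal_eq_of_edge_eq (f := p) fun i => by
      have := e4 i
      simp only [← hp, hx] at this
      rw [T.sum_inZ p i] at this
      linarith
    intro j
    have := hp j
    rw [hc j.succ, hc j.castSucc, sub_self] at this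
    exact this.symm
  ext c
  rcases c with c | i | j | j
  · fin_cases c
    · exact h1
    · simp only [hy, Finset.sum_const_zero, add_zero] at e2
      change v T.colA = 0
      linarith
  · exact hx i
  · exact hy j
  · exact hz j

theorem card_col : Fintype.card T.Col = n + T.k + T.l + 2 := by
  simp only [Fintype.card_sum, Fintype.card_fin]
  omega

/-- Subtracting from a kernel vector its height times the tiling solution leaves a kernel vector of
height 0, so the kernel is a line. -/
theorem rank_incidence : T.incidence.rank + 1 = Fintype.card T.Col := by
  have h := T.incidence.mulVecLin.finrank_range_add_finrank_ker
  rw [Module.finrank_fintype_fun_eq_card] at h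
  rw [← h]
  change T.incidence.rank + 1 = T.incidence.rank + _
  have hne : (⟨T.solution, T.mulVec_solution⟩ : LinearMap.ker T.incidence.mulVecLin) ≠ 0 :=
    fun h => T.solution_ne_zero (congrArg Subtype.val h)
  rw [(finrank_eq_one_iff_of_nonzero' _ hne).mpr]
  rintro ⟨v, hv⟩
  refine ⟨v T.colOne, Subtype.ext ?_⟩
  change v T.colOne • T.solution = v
  rw [← sub_eq_zero]
  refine T.eq_zero_of_mulVec_eq_zero ?_ ?_
  · rw [Matrix.mulVec_sub, Matrix.mulVec_smul, T.mulVec_solution]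
    have : T.incidence.mulVec v = 0 := hv
    simp [this]
  · simp [solution]

theorem exists_isMaxRankSelection : ∃ S : Finset (Row n), T.IsMaxRankSelection S := by
  classical
  obtain ⟨κ, f, hf, hspan, hli⟩ := exists_linearIndependent' ℝ T.incidence.row
  have : Fintype κ := Fintype.ofInjective f hf
  refine ⟨Finset.univ.image f, ?_, ?_⟩
  · rw [Finset.card_image_of_injective _ hf, Finset.card_univ, ← T.rank_incidence,
      Matrix.rank_eq_finrank_span_row, ← hspan, finrank_span_eq_card hli]
  · have h : ∀ r : (Finset.univ.image f : Finset (Row n)), ∃ x, f x = r.1 := fun r => by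
      obtain ⟨x, -, hx⟩ := Finset.mem_image.mp r.2
      exact ⟨x, hx⟩
    choose g hg using h
    have hg' : Function.Injective g := fun r s hrs => Subtype.ext (by rw [← hg, ← hg, hrs])
    have heq : (fun r : (Finset.univ.image f : Finset (Row n)) => T.incidence r.1) =
        (T.incidence.row ∘ f) ∘ g := by
      ext r c
      change T.incidence r.1 c = T.incidence (f (g r)) c
      rw [hg]
    rw [heq]
    exact hli.comp g hg'

/-! ### Selections of N - 1 independent rows -/

variable {T} {S : Finset (Row n)}

theorem IsMaxRankSelection.eq_smul (hS : T.IsMaxRankSelection S) {v : T.Col → ℝ}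
    (hv : ∀ r ∈ S, T.incidence.mulVec v r = 0) : ∃ c : ℝ, v = c • T.solution := by
  have hrank : Matrix.rank (fun r : S => T.incidence r.1 : Matrix S T.Col ℝ) = S.card := by
    rw [LinearIndependent.rank_matrix (M := (fun r : S => T.incidence r.1 : Matrix S T.Col ℝ)) hS.2]
    simp
  refine Matrix.eq_smul_of_rank_add_one_eq
    (M := (fun r : S => T.incidence r.1 : Matrix S T.Col ℝ)) ?_ T.solution_ne_zero ?_ ?_
  · rw [hrank, hS.1]
  · ext r
    exact congrFun T.mulVec_solution r.1
  · ext r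
    exact hv r.1 r.2

/-- Otherwise the unit vector of this column would solve the kept equations and be a multiple of the
solution, all of whose entries are positive; but it vanishes at some other column. -/
theorem IsMaxRankSelection.exists_ne_zero (hS : T.IsMaxRankSelection S) (c : T.Col) :
    ∃ r ∈ S, T.incidence r c ≠ 0 := by
  classical
  by_contra! h
  obtain ⟨t, ht⟩ := hS.eq_smul (v := Pi.single c 1) fun r hr => by
    rw [Matrix.mulVec_single_one]
    exact h r hr
  obtain ⟨c', hc'⟩ : ∃ c' : T.Col, c' ≠ c := by
    by_cases h : c = T.colOne
    · exact ⟨T.colA, by rw [h]; simp⟩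
    · exact ⟨T.colOne, Ne.symm h⟩
  have h1 := congrFun ht c'
  have h2 := congrFun ht c
  rw [Pi.single_eq_of_ne hc', Pi.smul_apply, smul_eq_mul] at h1
  have ht0 : t = 0 := by
    rcases mul_eq_zero.mp h1.symm with h | h
    · exact h
    · exact absurd h (T.solution_pos c').ne'
  simp [ht0] at h2

theorem IsMaxRankSelection.rowL1_mem (hS : T.IsMaxRankSelection S) : rowL1 ∈ S := by
  obtain ⟨r, hr, h⟩ := hS.exists_ne_zero T.colOne
  rcases r with r | i | i
  · fin_cases r
    · exact hr
    · simp [incidence] at h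
  · simp [incidence] at h
  · simp [incidence] at h

theorem IsMaxRankSelection.rowL2_mem (hS : T.IsMaxRankSelection S) : rowL2 ∈ S := by
  obtain ⟨r, hr, h⟩ := hS.exists_ne_zero T.colA
  rcases r with r | i | i
  · fin_cases r
    · simp [incidence] at h
    · exact hr
  · simp [incidence] at h
  · simp [incidence] at h

theorem IsMaxRankSelection.rowR1_mem_or_rowR2_mem (hS : T.IsMaxRankSelection S) (i : Fin n) :
    rowR1 i ∈ S ∨ rowR2 i ∈ S := by
  obtain ⟨r, hr, h⟩ := hS.exists_ne_zero (T.colX i)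
  rcases r with r | i' | i'
  · fin_cases r <;> simp [incidence] at h
  · left
    have : i = i' := by
      by_contra hne
      simp [incidence, hne] at h
    rwa [this]
  · right
    have : i = i' := by
      by_contra hne
      simp [incidence, hne] at h
    rwa [this]

open Classical in
/-- The squares for which both rows belong to the selection. -/
def doubled (S : Finset (Row n)) : Finset (Fin n) :=
  Finset.univ.filter fun i => rowR1 i ∈ S ∧ rowR2 i ∈ S

theorem mem_doubled {i : Fin n} : i ∈ doubled S ↔ rowR1 i ∈ S ∧ rowR2 i ∈ S := by
  simp [doubled]

/-- The n + k + l + 1 kept rows are L₁, L₂, one row for each square and a second one for each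
doubled square. -/
theorem IsMaxRankSelection.card_doubled (hS : T.IsMaxRankSelection S) :
    (doubled S).card + 1 = T.k + T.l := by
  classical
  have h1 : S.card = ∑ r : Row n, if r ∈ S then 1 else 0 := by simp
  have h2 : ∀ i : Fin n, ((if rowR1 i ∈ S then 1 else 0) + (if rowR2 i ∈ S then 1 else 0) : ℕ) =
      1 + if rowR1 i ∈ S ∧ rowR2 i ∈ S then 1 else 0 := by
    intro i
    rcases hS.rowR1_mem_or_rowR2_mem i with h | h <;> simp [h, add_comm]
  rw [Fintype.sum_sum_type, Fintype.sum_sum_type, Fin.sum_univ_two, if_pos hS.rowL1_mem,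
    if_pos hS.rowL2_mem, ← Finset.sum_add_distrib, Finset.sum_congr rfl fun i _ => h2 i,
    Finset.sum_add_distrib] at h1
  have h3 : (doubled S).card = ∑ i : Fin n, if rowR1 i ∈ S ∧ rowR2 i ∈ S then 1 else 0 := by
    rw [doubled, Finset.card_filter]
  have h4 := hS.1
  rw [T.card_col] at h4
  simp only [Finset.sum_const, Finset.card_univ, Fintype.card_fin, smul_eq_mul, mul_one] at h1
  omega

/-- Positions of the lines that satisfy the equations of the doubled squares are those of the
tiling up to scaling and translations. -/
theorem IsMaxRankSelection.exists_eq_add_mul (hS : T.IsMaxRankSelection S)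
    {p : Fin (T.k + 1) → ℝ} {q : Fin (T.l + 1) → ℝ}
    (h : ∀ i ∈ doubled S,
      p (T.rightIx i) - p (T.leftIx i) = q (T.topIx i) - q (T.botIx i)) :
    ∃ c : ℝ, (∀ j, p j = p 0 + c * T.vLine j) ∧ ∀ j, q j = q 0 + c * T.hLine j := by
  classical
  -- The x-entry is read off from a kept row of the square; where both are kept, `h` makes the two
  -- readings agree.
  let v : T.Col → ℝ := Sum.elim ![q (Fin.last _) - q 0, p (Fin.last _) - p 0]
    (Sum.elim (fun i => if rowR1 i ∈ S then p (T.rightIx i) - p (T.leftIx i)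
        else q (T.topIx i) - q (T.botIx i))
      (Sum.elim (fun j => p j.succ - p j.castSucc) fun j => q j.succ - q j.castSucc))
  obtain ⟨c, hc⟩ := hS.eq_smul (v := v) (by
    rintro (r | i | i) hr
    · fin_cases r
      · refine (T.mulVec_rowL1 v).trans ?_
        change -(q (Fin.last _) - q 0) + ∑ j : Fin T.l, (q j.succ - q j.castSucc) = 0
        rw [Fin.sum_succ_sub_castSucc]; ring
      · refine (T.mulVec_rowL2 v).trans ?_
        change -(p (Fin.last _) - p 0) + ∑ j : Fin T.k, (p j.succ - p j.castSucc) = 0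
        rw [Fin.sum_succ_sub_castSucc]; ring
    · refine (T.mulVec_rowR1 v i).trans ?_
      have h1 := T.sum_inY p i
      have h2 : v (T.colX i) = p (T.rightIx i) - p (T.leftIx i) := by simp [v, hr]
      rw [h2, ← h1]
      simp [v]
    · refine (T.mulVec_rowR2 v i).trans ?_
      have h1 := T.sum_inZ q i
      have h2 : v (T.colX i) = q (T.topIx i) - q (T.botIx i) := by
        by_cases hr1 : rowR1 i ∈ S
        · rw [← h i (mem_doubled.mpr ⟨hr1, hr⟩)]; simp [v, hr1]
        · simp [v, hr1]
      rw [h2, ← h1]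
      simp [v])
  refine ⟨c, fun j => ?_, fun j => ?_⟩
  · have := Fin.eq_of_forall_succ_eq_castSucc (f := fun j => p j - c * T.vLine j) (fun j => by
      have : p j.succ - p j.castSucc = c * (T.vLine j.succ - T.vLine j.castSucc) :=
        congrFun hc (T.colY j)
      linarith) j
    simp only [vLine_zero] at this
    linarith
  · have := Fin.eq_of_forall_succ_eq_castSucc (f := fun j => q j - c * T.hLine j) (fun j => by
      have : q j.succ - q j.castSucc = c * (T.hLine j.succ - T.hLine j.castSucc) :=
        congrFun hc (T.colZ j)
      linarith) j
    simp only [hLine_zero] at this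
    linarith

end SquareTiling

/-! ### Integral multipliers and denominators -/

theorem lcmDen_le {n k l : ℕ} {a : ℚ} {x : Fin n → ℚ} {y : Fin k → ℚ} {z : Fin l → ℚ} {m : ℤ}
    (hm : m ≠ 0) (ha : ∃ t : ℤ, (m : ℚ) * a = t) (hx : ∀ i, ∃ t : ℤ, (m : ℚ) * x i = t)
    (hy : ∀ i, ∃ t : ℤ, (m : ℚ) * y i = t) (hz : ∀ i, ∃ t : ℤ, (m : ℚ) * z i = t) :
    (lcmDen a x y z : ℝ) ≤ |(m : ℝ)| := by
  have key : ∀ q : ℚ, (∃ t : ℤ, (m : ℚ) * q = t) → q.den ∣ m.natAbs := by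
    rintro q ⟨t, ht⟩
    have hm' : (m : ℚ) ≠ 0 := by exact_mod_cast hm
    have : q = (t / m : ℚ) := by rw [eq_div_iff hm', ← ht, mul_comm]
    rw [this, ← Int.natCast_dvd, ← Rat.divInt_eq_div]
    exact Rat.den_dvd t m
  have hdvd : lcmDen a x y z ∣ m.natAbs :=
    Nat.lcm_dvd (key _ ha) (Nat.lcm_dvd (Finset.lcm_dvd fun i _ => key _ (hx i))
      (Nat.lcm_dvd (Finset.lcm_dvd fun i _ => key _ (hy i))
        (Finset.lcm_dvd fun i _ => key _ (hz i))))
  have h := Nat.le_of_dvd (Int.natAbs_pos.mpr hm) hdvd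
  calc (lcmDen a x y z : ℝ) ≤ (m.natAbs : ℝ) := by exact_mod_cast h
    _ = |(m : ℝ)| := by rw [Nat.cast_natAbs, Int.cast_abs]

namespace SquareTiling

variable {a : ℝ} {n : ℕ} (T : SquareTiling a n)

/-- Multiplication by `m ≠ 0` makes the positions of all grid lines integral. -/
def IsMultiplier (m : ℤ) : Prop :=
  m ≠ 0 ∧ (∀ j, ∃ t : ℤ, m * T.vLine j = t) ∧ ∀ j, ∃ t : ℤ, m * T.hLine j = t

/-- The equation "width = height" of each square, in the positions of the grid lines. -/
def edgeMatrix : Matrix (Fin n) (Fin (T.k + 1) ⊕ Fin (T.l + 1)) ℤ := fun i =>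
  Sum.elim (fun v => (if v = T.rightIx i then 1 else 0) - if v = T.leftIx i then 1 else 0)
    (fun v => (if v = T.botIx i then 1 else 0) - if v = T.topIx i then 1 else 0)

theorem edgeMatrix_sum (i : Fin n) (u : Fin (T.k + 1) ⊕ Fin (T.l + 1) → ℝ) :
    ∑ v, (T.edgeMatrix i v : ℝ) * u v =
      (u (Sum.inl (T.rightIx i)) - u (Sum.inl (T.leftIx i))) -
        (u (Sum.inr (T.topIx i)) - u (Sum.inr (T.botIx i))) := by
  simp [edgeMatrix, sub_mul]
  ring

theorem edgeMatrix_sum_sq (i : Fin n) : ∑ v, T.edgeMatrix i v ^ 2 ≤ 4 := by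
  have aux : ∀ {N : ℕ} (s t : Fin N), ∑ v, ((if v = s then 1 else 0) -
      if v = t then 1 else 0 : ℤ) ^ 2 ≤ 2 := by
    intro N s t
    -- For 0/1 indicators the squared difference is at most the sum, whether or not `s = t`.
    calc ∑ v, ((if v = s then 1 else 0) - if v = t then 1 else 0 : ℤ) ^ 2
        ≤ ∑ v, ((if v = s then 1 else 0) + if v = t then 1 else 0 : ℤ) :=
          Finset.sum_le_sum fun v _ => by split_ifs <;> norm_num
      _ = 2 := by rw [Finset.sum_add_distrib]; simp
  rw [Fintype.sum_sum_type]
  exact (add_le_add (aux (T.rightIx i) (T.leftIx i)) (aux (T.botIx i) (T.topIx i))).trans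
    (by norm_num)

variable {T} {S : Finset (Row n)}

/-- Three lines are pinned, at 0, 0 and 1: two remove the translations, and the top line removes the
scaling. The k + l - 1 remaining positions match the number of doubled squares. -/
theorem IsMaxRankSelection.exists_isMultiplier (hS : T.IsMaxRankSelection S) :
    ∃ m, T.IsMultiplier m ∧ |(m : ℝ)| * 2 ≤ 2 ^ (T.k + T.l) := by
  have hl := T.l_pos
  have hcard := hS.card_doubled
  have hlast : (0 : Fin (T.l + 1)) ≠ Fin.last T.l := by
    intro h; rw [Fin.ext_iff, Fin.val_zero, Fin.val_last] at h; omega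
  obtain ⟨d, hd0, hd, hw⟩ := exists_small_multiplier
    (fun (i : doubled S) => T.edgeMatrix i.1) (fun i => T.edgeMatrix_sum_sq i.1)
    ({Sum.inl 0, Sum.inr 0, Sum.inr (Fin.last _)}ᶜ : Finset (Fin (T.k + 1) ⊕ Fin (T.l + 1)))
    (by
      rw [Finset.card_compl, Finset.card_eq_three.mpr
        ⟨_, _, _, by simp, by simp, by simpa using hlast, rfl⟩]
      simp only [Fintype.card_sum, Fintype.card_fin, Fintype.card_coe]
      omega)
    (fun u hu0 hu => by
      have u1 := hu0 (Sum.inl 0) (by simp)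
      have u2 := hu0 (Sum.inr 0) (by simp)
      have u3 := hu0 (Sum.inr (Fin.last _)) (by simp)
      obtain ⟨c, hp, hq⟩ := hS.exists_eq_add_mul (p := fun j => u (Sum.inl j))
        (q := fun j => u (Sum.inr j)) fun i hi => by
          have := hu ⟨i, hi⟩
          rw [edgeMatrix_sum] at this
          linarith
      have hc : c = 0 := by
        have := hq (Fin.last _)
        rw [u3, u2, hLine_last] at this
        linarith
      ext (j | j)
      · simpa [hc, u1] using hp j
      · simpa [hc, u2] using hq j)
  have hint := hw (Sum.elim T.vLine T.hLine)
    (by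
      intro v hv
      simp only [Finset.mem_compl, not_not, Finset.mem_insert, Finset.mem_singleton] at hv
      rcases hv with rfl | rfl | rfl
      · exact ⟨0, by simp [vLine_zero]⟩
      · exact ⟨0, by simp [hLine_zero]⟩
      · exact ⟨1, by simp [hLine_last]⟩)
    (fun i => by
      rw [edgeMatrix_sum]
      simp only [Sum.elim_inl, Sum.elim_inr, vLine_leftIx, vLine_rightIx, hLine_botIx, hLine_topIx,
        right_sub_left, top_sub_bot, sub_self])
  refine ⟨d, ⟨hd0, fun j => hint (Sum.inl j), fun j => hint (Sum.inr j)⟩, ?_⟩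
  rw [← hcard, pow_succ, ← Fintype.card_coe]
  linarith

/-- The multiplier is `d / T.side i₀`, where `d` is the determinant of the system with the four
edges of this square pinned at 0, 1, 0, 1 and its equation dropped. -/
theorem IsMaxRankSelection.exists_isMultiplier_of_mem (hS : T.IsMaxRankSelection S) {i₀ : Fin n}
    (hi₀ : i₀ ∈ doubled S) :
    ∃ m, T.IsMultiplier m ∧ |(m : ℝ)| * T.side i₀ * 4 ≤ 2 ^ (T.k + T.l) := by
  classical
  have hk := T.k_pos
  have hcard := hS.card_doubled
  have hcard' := Finset.card_erase_add_one hi₀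
  have hs := T.side_pos i₀
  have hlr := (T.leftIx_lt_rightIx i₀).ne
  have hbt := (T.botIx_lt_topIx i₀).ne
  obtain ⟨d, hd0, hd, hw⟩ := exists_small_multiplier
    (fun (i : (doubled S).erase i₀) => T.edgeMatrix i.1) (fun i => T.edgeMatrix_sum_sq i.1)
    ({Sum.inl (T.leftIx i₀), Sum.inl (T.rightIx i₀), Sum.inr (T.botIx i₀),
      Sum.inr (T.topIx i₀)}ᶜ : Finset (Fin (T.k + 1) ⊕ Fin (T.l + 1)))
    (by
      rw [Finset.card_compl, Finset.card_insert_of_notMem (by simpa using hlr),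
        Finset.card_eq_three.mpr ⟨_, _, _, by simp, by simp, by simpa using hbt, rfl⟩]
      simp only [Fintype.card_sum, Fintype.card_fin, Fintype.card_coe]
      omega)
    (fun u hu0 hu => by
      have u1 := hu0 (Sum.inl (T.leftIx i₀)) (by simp)
      have u2 := hu0 (Sum.inl (T.rightIx i₀)) (by simp)
      have u3 := hu0 (Sum.inr (T.botIx i₀)) (by simp)
      have u4 := hu0 (Sum.inr (T.topIx i₀)) (by simp)
      obtain ⟨c, hp, hq⟩ := hS.exists_eq_add_mul (p := fun j => u (Sum.inl j))
        (q := fun j => u (Sum.inr j)) fun i hi => by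
          by_cases hii : i = i₀
          · rw [hii, u1, u2, u3, u4]
          have := hu ⟨i, Finset.mem_erase.mpr ⟨hii, hi⟩⟩
          rw [edgeMatrix_sum] at this
          linarith
      have hpl := hp (T.leftIx i₀)
      have hpr := hp (T.rightIx i₀)
      have hqb := hq (T.botIx i₀)
      rw [vLine_leftIx, u1] at hpl
      rw [vLine_rightIx, u2] at hpr
      rw [u3] at hqb
      have hc : c = 0 := by
        have : c * T.side i₀ = 0 := by rw [← right_sub_left]; linarith
        exact (mul_eq_zero.mp this).resolve_right hs.ne'
      rw [hc, zero_mul, add_zero] at hpl hqb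
      ext (j | j)
      · simpa [hc, ← hpl] using hp j
      · simpa [hc, ← hqb] using hq j)
  have hint := hw (Sum.elim (fun j => (T.vLine j - T.left i₀) / T.side i₀)
      fun j => (T.hLine j - T.bot i₀) / T.side i₀)
    (by
      intro v hv
      simp only [Finset.mem_compl, not_not, Finset.mem_insert, Finset.mem_singleton] at hv
      rcases hv with rfl | rfl | rfl | rfl
      · exact ⟨0, by simp [vLine_leftIx]⟩
      · exact ⟨1, by simp [vLine_rightIx, right_sub_left, hs.ne']⟩
      · exact ⟨0, by simp [hLine_botIx]⟩
      · exact ⟨1, by simp [hLine_topIx, top_sub_bot, hs.ne']⟩)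
    (fun i => by
      rw [edgeMatrix_sum]
      simp only [Sum.elim_inl, Sum.elim_inr, vLine_leftIx, vLine_rightIx, hLine_botIx, hLine_topIx,
        ← sub_div, sub_sub_sub_cancel_right, right_sub_left, top_sub_bot, sub_self])
  choose f hf using hint
  -- The rectangle has height 1 / `side i₀` in the new unit, and `d` times a difference of two line
  -- positions is an integer.
  have hm : (d : ℝ) / T.side i₀ = ((f (Sum.inr (Fin.last _)) - f (Sum.inr 0) : ℤ) : ℝ) := by
    rw [Int.cast_sub, ← hf, ← hf]
    simp only [Sum.elim_inr, hLine_last, hLine_zero]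
    ring
  have hd0' : (d : ℝ) ≠ 0 := by exact_mod_cast hd0
  refine ⟨f (Sum.inr (Fin.last _)) - f (Sum.inr 0), ⟨?_, fun j => ?_, fun j => ?_⟩, ?_⟩
  · intro h0
    rw [h0, Int.cast_zero] at hm
    exact div_ne_zero hd0' hs.ne' hm
  · refine ⟨f (Sum.inl j) - f (Sum.inl 0), ?_⟩
    rw [← hm, Int.cast_sub, ← hf, ← hf]
    simp only [Sum.elim_inl, vLine_zero]
    ring
  · refine ⟨f (Sum.inr j) - f (Sum.inr 0), ?_⟩
    rw [← hm, Int.cast_sub, ← hf, ← hf]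
    simp only [Sum.elim_inr, hLine_zero]
    ring
  -- The factor 4 is one 2 from `card_doubled` and one from the erased square.
  · rw [← hm, abs_div, abs_of_pos hs, div_mul_cancel₀ _ hs.ne', ← hcard, ← hcard', pow_succ,
      pow_succ, ← Fintype.card_coe]
    linarith

theorem IsMultiplier.integral {m : ℤ} (hm : T.IsMultiplier m) :
    (∃ t : ℤ, m * a = t) ∧ (∀ i, ∃ t : ℤ, m * T.side i = t) ∧
      (∀ j, ∃ t : ℤ, m * T.y j = t) ∧ ∀ j, ∃ t : ℤ, m * T.z j = t := by
  obtain ⟨-, hv, hh⟩ := hm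
  choose f hf using hv
  choose g hg using hh
  refine ⟨⟨f (Fin.last _), by rw [← hf, vLine_last]⟩,
    fun i => ⟨f (T.rightIx i) - f (T.leftIx i), ?_⟩,
    fun j => ⟨f j.succ - f j.castSucc, ?_⟩, fun j => ⟨g j.succ - g j.castSucc, ?_⟩⟩
  · rw [Int.cast_sub, ← hf, ← hf, vLine_rightIx, vLine_leftIx, ← mul_sub, right_sub_left]
  · rw [Int.cast_sub, ← hf, ← hf, ← mul_sub, y]
  · rw [Int.cast_sub, ← hg, ← hg, ← mul_sub, z]

theorem IsMultiplier.lcmDen_le {m : ℤ} (hm : T.IsMultiplier m) {a' : ℚ} {x' : Fin n → ℚ}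
    {y' : Fin T.k → ℚ} {z' : Fin T.l → ℚ} (ha : (a' : ℝ) = a) (hx : ∀ i, (x' i : ℝ) = T.side i)
    (hy : ∀ j, (y' j : ℝ) = T.y j) (hz : ∀ j, (z' j : ℝ) = T.z j) :
    (lcmDen a' x' y' z' : ℝ) ≤ |(m : ℝ)| := by
  have cast : ∀ {q : ℚ} {r : ℝ}, (q : ℝ) = r → (∃ t : ℤ, m * r = t) →
      ∃ t : ℤ, (m : ℚ) * q = t := by
    rintro q r rfl ⟨t, ht⟩
    exact ⟨t, by exact_mod_cast ht⟩
  obtain ⟨h1, h2, h3, h4⟩ := hm.integral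
  exact _root_.lcmDen_le hm.1 (cast ha h1) (fun i => cast (hx i) (h2 i))
    (fun i => cast (hy i) (h3 i)) (fun i => cast (hz i) (h4 i))

theorem exists_rat_of_mul_eq {m : ℤ} (hm : m ≠ 0) {r : ℝ} (h : ∃ t : ℤ, m * r = t) :
    ∃ q : ℚ, (q : ℝ) = r := by
  obtain ⟨t, ht⟩ := h
  have hm' : (m : ℝ) ≠ 0 := by exact_mod_cast hm
  refine ⟨t / m, ?_⟩
  push_cast
  rw [← ht, mul_div_cancel_left₀ _ hm']

end SquareTiling
end

/-! ### The bounds on the common denominator -/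

theorem theorem3 (a : ℝ) (n : ℕ) (T : SquareTiling a n) :
    ∃ (a' : ℚ) (x' : Fin n → ℚ) (y' : Fin T.k → ℚ) (z' : Fin T.l → ℚ),
      ((a' : ℝ) = a ∧ (∀ i, (x' i : ℝ) = T.side i) ∧
        (∀ j, (y' j : ℝ) = T.y j) ∧ (∀ j, (z' j : ℝ) = T.z j)) ∧
      (lcmDen a' x' y' z' : ℝ) ≤ (2 : ℝ) ^ ((T.k : ℤ) + (T.l : ℤ) - 1) ∧
      (2 : ℝ) ^ ((T.k : ℤ) + (T.l : ℤ) - 1) ≤ (2 : ℝ) ^ n ∧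
      (∃ S : Finset (SquareTiling.Row n), T.IsMaxRankSelection S) ∧
      ∀ S : Finset (SquareTiling.Row n), T.IsMaxRankSelection S →
        ∃ x : ℝ, IsGreatest {s : ℝ | ∃ i : Fin n, SquareTiling.rowR1 i ∈ S ∧
            SquareTiling.rowR2 i ∈ S ∧ s = T.side i} x ∧
          (lcmDen a' x' y' z' : ℝ) ≤ (2 : ℝ) ^ ((T.k : ℤ) + (T.l : ℤ) - 2) / x := by
  obtain ⟨S₀, hS₀⟩ := T.exists_isMaxRankSelection
  obtain ⟨m, hm, hm2⟩ := hS₀.exists_isMultiplier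
  obtain ⟨h1, h2, h3, h4⟩ := hm.integral
  obtain ⟨a', ha⟩ := SquareTiling.exists_rat_of_mul_eq hm.1 h1
  choose x' hx using fun i => SquareTiling.exists_rat_of_mul_eq hm.1 (h2 i)
  choose y' hy using fun i => SquareTiling.exists_rat_of_mul_eq hm.1 (h3 i)
  choose z' hz using fun i => SquareTiling.exists_rat_of_mul_eq hm.1 (h4 i)
  have hpow : (2 : ℝ) ^ ((T.k : ℤ) + (T.l : ℤ)) = 2 ^ (T.k + T.l) := by
    rw [← Nat.cast_add, zpow_natCast]
  refine ⟨a', x', y', z', ⟨ha, hx, hy, hz⟩, ?_, ?_, ⟨S₀, hS₀⟩, fun S hS => ?_⟩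
  · rw [zpow_sub_one₀ two_ne_zero, hpow, ← div_eq_mul_inv, le_div_iff₀ two_pos]
    exact (mul_le_mul_of_nonneg_right (hm.lcmDen_le ha hx hy hz) two_pos.le).trans hm2
  · rw [← zpow_natCast]
    refine zpow_le_zpow_right₀ one_le_two ?_
    -- There are k + l - 1 doubled squares among the n squares.
    have h := hS₀.card_doubled
    have h' := (SquareTiling.doubled S₀).card_le_univ
    rw [Fintype.card_fin] at h'
    omega
  · have hne : (SquareTiling.doubled S).Nonempty := by
      rw [← Finset.card_pos]
      have h := hS.card_doubled
      have := T.k_pos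
      have := T.l_pos
      omega
    obtain ⟨i, hi, hmax⟩ := Finset.exists_max_image _ T.side hne
    have hi' := SquareTiling.mem_doubled.mp hi
    refine ⟨T.side i, ⟨⟨i, hi'.1, hi'.2, rfl⟩, ?_⟩, ?_⟩
    · rintro _ ⟨j, hj1, hj2, rfl⟩
      exact hmax j (SquareTiling.mem_doubled.mpr ⟨hj1, hj2⟩)
    · obtain ⟨m', hm', hle⟩ := hS.exists_isMultiplier_of_mem hi
      have hs := T.side_pos i
      have h := hm'.lcmDen_le ha hx hy hz
      rw [le_div_iff₀ hs, zpow_sub₀ two_ne_zero, hpow]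
      have h5 := mul_le_mul_of_nonneg_right h hs.le
      have h6 : (2 : ℝ) ^ (2 : ℤ) = 4 := by norm_num
      rw [h6, le_div_iff₀ (by norm_num)]
      linarith
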